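/- Let $X$ be a (real) Banach lattice and let $\mathcal S$ be a semigroup of positive bounded operators on $X$ (a set of such operators closed under composition) which is $\mathbb R_+$-closed, i.e. norm closed in $L(X)$ and closed under multiplication by positive scalars, and ideal irreducible, i.e. no closed lattice ideal of $X$ other than $\{0\}$ and $X$ is invariant under all operators in $\mathcal S$. Assume that $\mathcal S$ contains a non-zero operator of finite rank, let $r$ be the minimal rank of the non-zero operators in $\mathcal S$, and let $\mathcal P_r$ be the set of all projections (idempotents) of rank $r$ in $\mathcal S$. A right ideal of $\mathcal S$ is a non-empty set $\mathcal J\subseteq\mathcal S$ with $AB\in\mathcal J$ for all $A\in\mathcal J$, $B\in\mathcal S$; it is a two-sided ideal if also $BA\in\mathcal J$ for all such $A,B$. A minimal right ideal is a right ideal that is minimal with respect to inclusion among the right ideals different from $\{0\}$. (a) The minimal right ideals of $\mathcal S$ are exactly the sets $P\mathcal S=\{PT : T\in\mathcal S\}$ with $P\in\mathcal P_r$. (b) For $P\in\mathcal P_r$, the right ideal $P\mathcal S$ is a two-sided ideal of $\mathcal S$ if and only if $\operatorname{Range}P$ is invariant under every $T\in\mathcal S$. (c) The following are equivalent: (i)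 all projections in $\mathcal P_r$ have the same range; (ii) every minimal right ideal of $\mathcal S$ is a two-sided ideal; (iii) some minimal right ideal of $\mathcal S$ is a two-sided ideal; (iv) $\mathcal S$ has a unique minimal right ideal. -/

import Mathlib

/-- `T` maps the positive cone of `X` into itself. -/
def IsPositiveOperator {X : Type*} [NormedAddCommGroup X] [Lattice X] [NormedSpace ℝ X]
    (T : X →L[ℝ] X) : Prop :=
  ∀ x : X, 0 ≤ x → 0 ≤ T x

/-- A set of operators is `ℝ₊`-closed if it is closed in the operator norm and closed under
multiplication by positive scalars. -/
def IsRPlusClosed {X : Type*} [NormedAddCommGroup X] [NormedSpace ℝ X]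
    (S : Set (X →L[ℝ] X)) : Prop :=
  IsClosed S ∧ ∀ c : ℝ, 0 < c → ∀ T ∈ S, c • T ∈ S

/-- `S` has no common invariant closed (lattice) ideals other than `0` and `X`.  A lattice ideal is
a linear subspace that is solid: `x ∈ J` and `|y| ≤ |x|` imply `y ∈ J`. -/
def IsIdealIrreducible {X : Type*} [NormedAddCommGroup X] [Lattice X] [NormedSpace ℝ X]
    (S : Set (X →L[ℝ] X)) : Prop :=
  ∀ J : Submodule ℝ X, IsClosed (J : Set X) →
    LatticeOrderedAddCommGroup.IsSolid (J : Set X) →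
    (∀ T ∈ S, ∀ x ∈ J, T x ∈ J) → J = ⊥ ∨ J = ⊤

/-- The rank (dimension of the range) of an operator, `⊤` if the range is infinite-dimensional. -/
noncomputable def opRank {X : Type*} [NormedAddCommGroup X] [NormedSpace ℝ X]
    (T : X →L[ℝ] X) : ℕ∞ :=
  Cardinal.toENat (LinearMap.rank (T : X →ₗ[ℝ] X))

/-- The minimal rank of the non-zero elements of `S`; it is `⊤` if `S` contains no non-zero
operator of finite rank. -/
noncomputable def minRank {X : Type*} [NormedAddCommGroup X] [NormedSpace ℝ X]
    (S : Set (X →L[ℝ] X)) : ℕ∞ :=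
  ⨅ T ∈ {T : X →L[ℝ] X | T ∈ S ∧ T ≠ 0}, opRank T

/-- The set of all projections in `S` whose rank is the minimal non-zero rank. -/
def minRankProjections {X : Type*} [NormedAddCommGroup X] [NormedSpace ℝ X]
    (S : Set (X →L[ℝ] X)) : Set (X →L[ℝ] X) :=
  {P | P ∈ S ∧ IsIdempotentElem P ∧ opRank P = minRank S}

/-- Right ideals of a semigroup `S` (in the sense of semigroup theory). -/
def IsRightIdealOf {M : Type*} [Mul M] (S : Subsemigroup M) (J : Set M) : Prop :=
  J.Nonempty ∧ J ⊆ S ∧ ∀ A ∈ J, ∀ B ∈ S, A * B ∈ J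

/-- Two-sided ideals of a semigroup `S` (in the sense of semigroup theory). -/
def IsTwoSidedIdealOf {M : Type*} [Mul M] (S : Subsemigroup M) (J : Set M) : Prop :=
  J.Nonempty ∧ J ⊆ S ∧ (∀ A ∈ J, ∀ B ∈ S, A * B ∈ J) ∧ ∀ A ∈ J, ∀ B ∈ S, B * A ∈ J

/-- Minimal elements, for inclusion, among the non-zero right ideals of `S`. -/
def IsMinimalRightIdealOf {M : Type*} [Mul M] [Zero M] (S : Subsemigroup M) (J : Set M) : Prop :=
  Minimal (fun I : Set M => IsRightIdealOf S I ∧ I ≠ {0}) J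

open Filter Topology

theorem abs_smul_le_smul_abs {X : Type*} [AddCommGroup X] [Lattice X] [IsOrderedAddMonoid X]
    [Module ℝ X] [IsOrderedModule ℝ X] (c : ℝ) (x : X) : |c • x| ≤ |c| • |x| := by
  have key : ∀ (d : ℝ) (y : X), d • y ≤ |d| • |y| := by
    intro d y
    rcases le_total 0 d with hd | hd
    · rw [abs_of_nonneg hd]
      exact smul_le_smul_of_nonneg_left (le_abs_self y) hd
    · rw [abs_of_nonpos hd, ← neg_smul_neg]
      exact smul_le_smul_of_nonneg_left (neg_le_abs y) (neg_nonneg.2 hd)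
  refine abs_le'.2 ⟨key c x, ?_⟩
  rw [← smul_neg, ← abs_neg x]
  exact key c (-x)

/-! ### Null ideals and primeness of irreducible semigroups. -/

section NullIdeal

variable {X : Type*} [NormedAddCommGroup X] [Lattice X] [NormedSpace ℝ X]

theorem IsPositiveOperator.mul {A B : X →L[ℝ] X} (hA : IsPositiveOperator A)
    (hB : IsPositiveOperator B) : IsPositiveOperator (A * B) :=
  fun x hx => hA _ (hB x hx)

variable [IsOrderedAddMonoid X]

theorem IsPositiveOperator.mono {T : X →L[ℝ] X} (hT : IsPositiveOperator T) {x y : X}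
    (hxy : x ≤ y) : T x ≤ T y := by
  have h := hT (y - x) (sub_nonneg.2 hxy)
  rwa [map_sub, sub_nonneg] at h

theorem IsPositiveOperator.abs_apply_le {T : X →L[ℝ] X} (hT : IsPositiveOperator T) (x : X) :
    |T x| ≤ T |x| := by
  refine abs_le'.2 ⟨hT.mono (le_abs_self x), ?_⟩
  rw [← map_neg]
  exact hT.mono (neg_le_abs x)

theorem IsPositiveOperator.apply_abs_eq_zero_of_le {T : X →L[ℝ] X} (hT : IsPositiveOperator T)
    {x y : X} (hx : T |x| = 0) (h : |y| ≤ |x|) : T |y| = 0 :=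
  le_antisymm (hx ▸ hT.mono h) (hT _ (abs_nonneg y))

theorem IsPositiveOperator.apply_eq_zero [HasSolidNorm X] {T : X →L[ℝ] X} (hT : IsPositiveOperator T)
    {x : X} (hx : T |x| = 0) : T x = 0 := by
  have h : |T x| = 0 := le_antisymm (hx ▸ hT.abs_apply_le x) (abs_nonneg _)
  rw [← norm_eq_zero, ← norm_abs_eq_norm, h, norm_zero]

/-- The common null ideal of a family of positive operators. -/
def nullIdeal [IsOrderedModule ℝ X] (F : Set (X →L[ℝ] X))
    (hF : ∀ T ∈ F, IsPositiveOperator T) : Submodule ℝ X where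
  carrier := {z | ∀ T ∈ F, T |z| = 0}
  zero_mem' := by simp
  add_mem' {x y} hx hy T hT := by
    refine le_antisymm (((hF T hT).mono (abs_add_le x y)).trans ?_) (hF T hT _ (abs_nonneg _))
    rw [map_add, hx T hT, hy T hT, add_zero]
  smul_mem' c x hx T hT := by
    refine le_antisymm (((hF T hT).mono (abs_smul_le_smul_abs c x)).trans ?_)
      (hF T hT _ (abs_nonneg _))
    rw [map_smul, hx T hT, smul_zero]

theorem mem_nullIdeal [IsOrderedModule ℝ X] {F : Set (X →L[ℝ] X)}
    {hF : ∀ T ∈ F, IsPositiveOperator T} {z : X} : z ∈ nullIdeal F hF ↔ ∀ T ∈ F, T |z| = 0 :=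
  Iff.rfl

theorem isClosed_nullIdeal [HasSolidNorm X] [IsOrderedModule ℝ X] (F : Set (X →L[ℝ] X))
    (hF : ∀ T ∈ F, IsPositiveOperator T) : IsClosed (nullIdeal F hF : Set X) := by
  have h : (nullIdeal F hF : Set X) = ⋂ T ∈ F, {z | T |z| = 0} := by
    ext z
    simp [mem_nullIdeal]
  rw [h]
  refine isClosed_biInter fun T _ => isClosed_eq ?_ continuous_const
  exact T.continuous.comp (continuous_id.sup continuous_neg)

/-- In an ideal irreducible family, the null ideal of a nonzero family `F` stable under right
multiplication is trivial. -/
theorem nullIdeal_eq_bot [HasSolidNorm X] [IsOrderedModule ℝ X] {S F : Set (X →L[ℝ] X)}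
    (hirr : IsIdealIrreducible S) (hpos : ∀ T ∈ S, IsPositiveOperator T)
    (hF : ∀ T ∈ F, IsPositiveOperator T) (hFS : ∀ A ∈ F, ∀ T ∈ S, A * T ∈ F)
    {A : X →L[ℝ] X} (hA : A ∈ F) (hA0 : A ≠ 0) : nullIdeal F hF = ⊥ := by
  refine (hirr (nullIdeal F hF) (isClosed_nullIdeal F hF) ?_ ?_).resolve_right ?_
  · intro x hx y hxy T hT
    exact (hF T hT).apply_abs_eq_zero_of_le (hx T hT) hxy
  -- Invariance: `B |T x| ≤ B (T |x|) = 0`, because `B * T` is again in `F`.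
  · intro T hT x hx B hB
    exact le_antisymm
      (((hF B hB).mono ((hpos T hT).abs_apply_le x)).trans (hx _ (hFS B hB T hT)).le)
      (hF B hB _ (abs_nonneg _))
  · intro h
    refine hA0 (ContinuousLinearMap.ext fun x => (hF A hA).apply_eq_zero ?_)
    have hx : x ∈ nullIdeal F hF := h ▸ Submodule.mem_top
    exact hx A hA

/-- If `A * T * B = 0` for all `T`, positivity puts every `B |x|` in the null ideal of `A * S`. That
ideal is trivial unless `A * S = 0`, a degenerate case needing its own argument. -/
theorem exists_mul_mul_ne_zero [HasSolidNorm X] [IsOrderedModule ℝ X] {S : Subsemigroup (X →L[ℝ] X)}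
    (hpos : ∀ T ∈ S, IsPositiveOperator T) (hirr : IsIdealIrreducible (S : Set (X →L[ℝ] X)))
    {A B : X →L[ℝ] X} (hA : A ∈ S) (hA0 : A ≠ 0) (hB : B ∈ S) (hB0 : B ≠ 0) :
    ∃ T ∈ S, A * T * B ≠ 0 := by
  by_contra! h
  have key : ∀ C ∈ S, C ≠ 0 → (∃ T ∈ S, A * T * C ≠ 0) ∨ ∀ T ∈ S, A * T = 0 := by
    intro C hC hC0
    by_contra! hcon
    obtain ⟨h1, T, hT, hT0⟩ := hcon
    let F : Set (X →L[ℝ] X) := {D | ∃ T ∈ S, D = A * T}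
    have hF : ∀ D ∈ F, IsPositiveOperator D := by
      rintro _ ⟨T, hT, rfl⟩
      exact (hpos A hA).mul (hpos T hT)
    have hbot := nullIdeal_eq_bot (F := F) hirr hpos hF
      (by rintro _ ⟨T, hT, rfl⟩ U hU; exact ⟨T * U, S.mul_mem hT hU, mul_assoc _ _ _⟩)
      ⟨T, hT, rfl⟩ hT0
    refine hC0 (ContinuousLinearMap.ext fun x => (hpos C hC).apply_eq_zero ?_)
    have hx : C |x| ∈ nullIdeal F hF := by
      rintro _ ⟨T, hT, rfl⟩
      rw [abs_of_nonneg (hpos C hC _ (abs_nonneg x))]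
      exact congrArg (fun D : X →L[ℝ] X => D |x|) (h1 T hT)
    simpa [hbot] using hx
  rcases key B hB hB0 with ⟨T, hT, hT0⟩ | h0
  · exact hT0 (h T hT)
  -- Here `A * S = 0`, so `{A, 0}` is stable under right multiplication; since `A * A = 0`, its null
  -- ideal contains the range of `A`.
  let F : Set (X →L[ℝ] X) := {D | D ∈ S ∧ D = A ∨ D = 0}
  have hF : ∀ D ∈ F, IsPositiveOperator D := by
    rintro D (⟨hD, -⟩ | rfl)
    · exact hpos D hD
    · intro x _
      simp
  have hbot := nullIdeal_eq_bot (F := F) hirr hpos hF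
    (by
      rintro _ (⟨-, rfl⟩ | rfl) U hU
      · exact Or.inr (h0 U hU)
      · exact Or.inr (zero_mul U))
    (Or.inl ⟨hA, rfl⟩) hA0
  refine hA0 (ContinuousLinearMap.ext fun x => ?_)
  have hx : A x ∈ nullIdeal F hF := by
    rintro D (⟨-, rfl⟩ | rfl)
    · refine le_antisymm (((hpos D hA).mono ((hpos D hA).abs_apply_le x)).trans ?_)
        (hpos D hA _ (abs_nonneg _))
      exact (congrArg (fun E : X →L[ℝ] X => E |x|) (h0 D hA)).le
    · simp
  simpa [hbot] using hx

end NullIdeal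

/-! ### Negative powers in closed cones. -/

section FiniteDimensionalAlgebra

/-- Let `K` be a closed cone in a finite-dimensional algebra whose nonzero elements are invertible.
If `K` contains the powers of a unit `u`, then it contains all `u⁻¹ ^ k`. -/
theorem inv_pow_mem_of_isClosed {A : Type*} [NormedRing A] [NormedAlgebra ℝ A]
    [FiniteDimensional ℝ A] [Nontrivial A] {K : Set A} (hK : IsClosed K)
    (hcone : ∀ c : ℝ, 0 < c → ∀ a ∈ K, c • a ∈ K) (hunit : ∀ a ∈ K, a ≠ 0 → IsUnit a)
    (u : Aˣ) (hu : ∀ n : ℕ, (u : A) ^ n ∈ K) (k : ℕ) : ((u⁻¹ ^ k : Aˣ) : A) ∈ K := by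
  have : ProperSpace A := FiniteDimensional.proper_real A
  have : CompleteSpace A := FiniteDimensional.complete ℝ A
  -- The normalised powers have a limit point `m ∈ K` of norm one, hence a unit. Quotients of terms
  -- along the subsequence therefore tend to `1`.
  let s : ℕ → ℝ := fun n => ‖(u : A) ^ n‖⁻¹
  have hs : ∀ n, 0 < s n := fun n => by
    have : (u : A) ^ n ≠ 0 := by exact_mod_cast (u ^ n).ne_zero
    exact inv_pos.2 (norm_pos_iff.2 this)
  have hsphere : ∀ n, s n • (u : A) ^ n ∈ Metric.sphere (0 : A) 1 := fun n => by
    rw [mem_sphere_zero_iff_norm, norm_smul, Real.norm_of_nonneg (hs n).le]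
    exact inv_mul_cancel₀ (inv_pos.1 (hs n)).ne'
  obtain ⟨m, hm, φ, hφ, hlim⟩ := (isCompact_sphere (0 : A) 1).tendsto_subseq hsphere
  have hmK : m ∈ K := hK.mem_of_tendsto hlim
    (Eventually.of_forall fun n => hcone _ (hs _) _ (hu _))
  obtain ⟨v, rfl⟩ := hunit m hmK (fun h => by simp [h] at hm)
  have hlim' := hlim.comp (tendsto_add_atTop_nat k)
  have hinv := (NormedRing.inverse_continuousAt v).tendsto.comp hlim
  have hprod := (hlim'.mul hinv).const_mul ((u⁻¹ ^ k : Aˣ) : A)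
  rw [Ring.inverse_unit, Units.mul_inv, mul_one] at hprod
  refine hK.mem_of_tendsto hprod (Eventually.of_forall fun n => ?_)
  -- Shifting the subsequence by `k` raises the exponent by at least `k`, so after multiplication by
  -- `u⁻¹ ^ k` the quotient is still a positive multiple of a nonnegative power of `u`.
  have hgap : ∀ j, φ n + j ≤ φ (n + j) := by
    intro j
    induction j with
    | zero => simp
    | succ j ih =>
      have := hφ (Nat.lt_succ_self (n + j))
      have h2 : n + (j + 1) = (n + j).succ := rfl
      rw [h2]
      omega
  obtain ⟨d, hd⟩ := Nat.exists_eq_add_of_le (hgap k)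
  have hinv' : Ring.inverse (s (φ n) • (u : A) ^ φ n) = (s (φ n))⁻¹ • ((u⁻¹ ^ φ n : Aˣ) : A) := by
    have h1 : s (φ n) • (u : A) ^ φ n = ((Units.mk0 (s (φ n)) (hs _).ne' • u ^ φ n : Aˣ) : A) := by
      simp [Units.smul_def]
    rw [h1, Ring.inverse_unit]
    simp [Units.smul_def]
  have hval : ((u⁻¹ ^ k : Aˣ) : A) * (s (φ (n + k)) • (u : A) ^ φ (n + k) *
      Ring.inverse (s (φ n) • (u : A) ^ φ n)) = (s (φ (n + k)) * (s (φ n))⁻¹) • (u : A) ^ d := by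
    rw [hinv', smul_mul_smul_comm, mul_smul_comm]
    congr 1
    rw [hd, ← Units.val_pow_eq_pow_val, ← Units.val_pow_eq_pow_val, ← Units.val_mul,
      ← Units.val_mul]
    congr 1
    rw [pow_add, pow_add, inv_pow, inv_pow]
    have := ((Commute.refl u).pow_pow d (φ n)).eq
    have h3 := ((Commute.refl u).pow_pow (φ n) k).eq
    rw [mul_assoc (u ^ φ n * u ^ k), ← div_eq_mul_inv (u ^ d), h3]
    rw [mul_assoc, inv_mul_cancel_left, div_eq_mul_inv, ← mul_assoc, ← this, mul_inv_cancel_right]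
  simp only [Function.comp_apply]
  rw [hval]
  exact hcone _ (mul_pos (hs _) (inv_pos.2 (hs _))) _ (hu d)

end FiniteDimensionalAlgebra

/-! ### Operators of minimal rank and their ranges. -/

section MinimalRank

variable {X : Type*} [NormedAddCommGroup X] [NormedSpace ℝ X]

theorem minRank_le_opRank {S : Set (X →L[ℝ] X)} {T : X →L[ℝ] X} (hT : T ∈ S) (hT0 : T ≠ 0) :
    minRank S ≤ opRank T :=
  iInf₂_le T ⟨hT, hT0⟩

theorem opRank_eq (T : X →L[ℝ] X) :
    opRank T = Cardinal.toENat (Module.rank ℝ (LinearMap.range (T : X →ₗ[ℝ] X))) :=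
  rfl

theorem opRank_zero : opRank (0 : X →L[ℝ] X) = 0 := by
  simp [opRank]

theorem opRank_ne_zero {T : X →L[ℝ] X} (hT : T ≠ 0) : opRank T ≠ 0 := by
  rw [opRank_eq, Ne, Cardinal.toENat_eq_zero, Submodule.rank_eq_zero, LinearMap.range_eq_bot]
  exact fun h => hT (ContinuousLinearMap.coe_injective h)

theorem opRank_mono {A B : X →L[ℝ] X}
    (h : LinearMap.range (A : X →ₗ[ℝ] X) ≤ LinearMap.range (B : X →ₗ[ℝ] X)) :
    opRank A ≤ opRank B := by
  rw [opRank_eq, opRank_eq]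
  exact OrderHomClass.mono _ (Submodule.rank_mono h)

theorem opRank_mul_le_left (A B : X →L[ℝ] X) : opRank (A * B) ≤ opRank A :=
  OrderHomClass.mono _ (LinearMap.rank_comp_le_left (B : X →ₗ[ℝ] X) (A : X →ₗ[ℝ] X))

theorem opRank_mul_le_right (A B : X →L[ℝ] X) : opRank (A * B) ≤ opRank B := by
  have := LinearMap.lift_rank_comp_le_right (B : X →ₗ[ℝ] X) (A : X →ₗ[ℝ] X)
  rw [Cardinal.lift_id, Cardinal.lift_id] at this
  exact OrderHomClass.mono Cardinal.toENat this

theorem finiteDimensional_range_of_opRank_lt_top {T : X →L[ℝ] X} (h : opRank T < ⊤) :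
    FiniteDimensional ℝ (LinearMap.range (T : X →ₗ[ℝ] X)) := by
  rw [opRank_eq, Cardinal.toENat_lt_top] at h
  exact Module.rank_lt_aleph0_iff.1 h

theorem range_eq_of_opRank_le {A B : X →L[ℝ] X}
    (h : LinearMap.range (A : X →ₗ[ℝ] X) ≤ LinearMap.range (B : X →ₗ[ℝ] X))
    (hB : opRank B < ⊤) (hrank : opRank B ≤ opRank A) :
    LinearMap.range (A : X →ₗ[ℝ] X) = LinearMap.range (B : X →ₗ[ℝ] X) := by
  have := finiteDimensional_range_of_opRank_lt_top hB
  refine Submodule.eq_of_le_of_finrank_le h ?_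
  have hA : opRank A < ⊤ := (opRank_mono h).trans_lt hB
  rw [opRank_eq, Cardinal.toENat_lt_top] at hA hB
  rw [opRank_eq, opRank_eq, Cardinal.toENat_le_iff_of_lt_aleph0 hA] at hrank
  exact Cardinal.toNat_le_toNat hrank hA

theorem exists_opRank_eq_minRank {S : Set (X →L[ℝ] X)} (h : minRank S < ⊤) :
    ∃ T ∈ S, T ≠ 0 ∧ opRank T = minRank S := by
  have hne : Nonempty {T : X →L[ℝ] X // T ∈ S ∧ T ≠ 0} := by
    by_contra hcon
    rw [not_nonempty_iff, isEmpty_subtype] at hcon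
    refine h.ne (iInf₂_eq_top.2 fun T hT => absurd hT (hcon T))
  have heq : minRank S = ⨅ T : {T : X →L[ℝ] X // T ∈ S ∧ T ≠ 0}, opRank T.1 := by
    rw [minRank, iInf_subtype']
    rfl
  obtain ⟨T, hT⟩ := ciInf_mem fun T : {T : X →L[ℝ] X // T ∈ S ∧ T ≠ 0} => opRank T.1
  exact ⟨T.1, T.2.1, T.2.2, by rw [heq]; exact hT⟩

theorem ne_zero_of_opRank_eq_minRank {S : Set (X →L[ℝ] X)} (h : minRank S < ⊤)
    {T : X →L[ℝ] X} (hT : opRank T = minRank S) : T ≠ 0 := by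
  obtain ⟨U, -, hU0, hU⟩ := exists_opRank_eq_minRank h
  rintro rfl
  exact opRank_ne_zero hU0 (by rw [hU, ← hT, opRank_zero])

/-- An operator of minimal rank with nonzero square has a right inverse on its range within `S`. -/
theorem exists_rightInverse_on_range {S : Subsemigroup (X →L[ℝ] X)}
    (hclosed : IsRPlusClosed (S : Set (X →L[ℝ] X)))
    (hrank : minRank (S : Set (X →L[ℝ] X)) < ⊤) {C : X →L[ℝ] X} (hC : C ∈ S)
    (hCr : opRank C = minRank (S : Set (X →L[ℝ] X))) (hC2 : C * C ≠ 0) :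
    ∃ D ∈ S, ∀ x, C (D (C x)) = C x := by
  let V := LinearMap.range (C : X →ₗ[ℝ] X)
  have hV : FiniteDimensional ℝ V := finiteDimensional_range_of_opRank_lt_top (hCr ▸ hrank)
  let C₀ : X →L[ℝ] V := C.codRestrict V fun x => ⟨x, rfl⟩
  have hC₀ : Function.Surjective C₀ := by
    rintro ⟨_, x, rfl⟩
    exact ⟨x, rfl⟩
  have hC0 : C ≠ 0 := by
    rintro rfl
    simp at hC2
  have hVnt : Nontrivial V := by
    obtain ⟨x, hx⟩ : ∃ x, C x ≠ 0 := by
      by_contra! h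
      exact hC0 (ContinuousLinearMap.ext h)
    exact ⟨⟨C x, x, rfl⟩, 0, fun h => hx (congrArg Subtype.val h)⟩
  -- `φ` transports the problem to the finite-dimensional algebra of operators on `V`; the preimage
  -- of `S` is a closed cone there, whose nonzero elements are invertible by minimality of the rank.
  let φ : (V →L[ℝ] V) → (X →L[ℝ] X) := fun M => V.subtypeL.comp (M.comp C₀)
  have hφ : Continuous φ :=
    continuous_const.clm_comp (continuous_id.clm_comp continuous_const)
  have hφ0 : ∀ M, M ≠ 0 → φ M ≠ 0 := by
    intro M hM h
    refine hM (ContinuousLinearMap.ext fun v => Subtype.ext ?_)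
    obtain ⟨x, rfl⟩ := hC₀ v
    exact congrArg (fun E : X →L[ℝ] X => E x) h
  have hunit : ∀ M, φ M ∈ S → M ≠ 0 → IsUnit M := by
    intro M hM hM0
    have hle : LinearMap.range (φ M : X →ₗ[ℝ] X) ≤ V := by
      rintro _ ⟨x, rfl⟩
      exact (M (C₀ x)).2
    have heq := range_eq_of_opRank_le hle (hCr ▸ hrank)
      (hCr ▸ minRank_le_opRank hM (hφ0 M hM0))
    rw [ContinuousLinearMap.isUnit_iff_bijective]
    have hsurj : Function.Surjective (M : V →ₗ[ℝ] V) := by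
      rintro ⟨v, hv⟩
      have hv' : v ∈ LinearMap.range (φ M : X →ₗ[ℝ] X) := heq ▸ hv
      obtain ⟨x, hx⟩ := hv'
      exact ⟨C₀ x, Subtype.ext hx⟩
    exact ⟨LinearMap.injective_iff_surjective.2 hsurj, hsurj⟩
  let N : V →L[ℝ] V := C₀.comp V.subtypeL
  have hφN : φ N = C * C := rfl
  obtain ⟨u, hu⟩ := hunit N (hφN ▸ S.mul_mem hC hC) (by
    intro h
    refine hC2 ?_
    rw [← hφN, h]
    ext x
    simp [φ])
  -- `N` is `C` restricted to its range, so `φ (N ^ n)` is `C ^ (n + 1)`; the exponent `0` gives `C`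
  -- itself, and no identity is needed in `S`.
  have hpow : ∀ n : ℕ, φ (N ^ n) ∈ S := by
    intro n
    induction n with
    | zero => exact hC
    | succ n ih =>
      have : φ (N ^ (n + 1)) = φ (N ^ n) * C := by
        rw [pow_succ]
        rfl
      rw [this]
      exact S.mul_mem ih hC
  -- The exponent is `2` because, with `D = φ M`, the product `C * D * C` is `φ (N * M * N)`, which
  -- must equal `φ 1 = C`.
  have hmem := inv_pow_mem_of_isClosed (K := φ ⁻¹' (S : Set (X →L[ℝ] X)))
    (hclosed.1.preimage hφ)
    (fun c hc M hM => by
      have : φ (c • M) = c • φ M := by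
        ext x
        simp [φ]
      rw [Set.mem_preimage, this]
      exact hclosed.2 c hc _ hM) (fun M hM hM0 => hunit M hM hM0) u (fun n => hu ▸ hpow n) 2
  refine ⟨_, hmem, fun x => ?_⟩
  have h1 : N * ((u⁻¹ ^ 2 : (V →L[ℝ] V)ˣ) : V →L[ℝ] V) * N = 1 := by
    rw [← hu, ← Units.val_mul, ← Units.val_mul]
    simp [pow_two]
  exact congrArg (fun E : V →L[ℝ] V => (E (C₀ x) : X)) h1

theorem mul_eq_right_iff_range_le {P : X →L[ℝ] X} (hP : IsIdempotentElem P) {T : X →L[ℝ] X} :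
    P * T = T ↔ Set.range T ⊆ Set.range P := by
  constructor
  · rintro h _ ⟨x, rfl⟩
    exact ⟨T x, congrArg (fun E : X →L[ℝ] X => E x) h⟩
  · intro h
    ext x
    obtain ⟨y, hy⟩ := h ⟨x, rfl⟩
    change P (T x) = T x
    rw [← hy]
    exact congrArg (fun E : X →L[ℝ] X => E y) hP.eq

theorem isRightIdealOf_mul_image {M : Type*} [Semigroup M] {S : Subsemigroup M} {P : M}
    (hP : P ∈ S) : IsRightIdealOf S ((fun T : M => P * T) '' (S : Set M)) := by
  refine ⟨⟨_, P, hP, rfl⟩, ?_, ?_⟩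
  · rintro _ ⟨T, hT, rfl⟩
    exact S.mul_mem hP hT
  · rintro _ ⟨T, hT, rfl⟩ B hB
    exact ⟨T * B, S.mul_mem hT hB, (mul_assoc _ _ _).symm⟩

theorem mem_mul_image_self {S : Subsemigroup (X →L[ℝ] X)} {P : X →L[ℝ] X} (hP : P ∈ minRankProjections (S : Set (X →L[ℝ] X))) :
    P ∈ (fun T : X →L[ℝ] X => P * T) '' (S : Set (X →L[ℝ] X)) :=
  ⟨P, hP.1, hP.2.1.eq⟩

theorem mul_image_ne_zero {S : Subsemigroup (X →L[ℝ] X)}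
    (hrank : minRank (S : Set (X →L[ℝ] X)) < ⊤) {P : X →L[ℝ] X}
    (hP : P ∈ minRankProjections (S : Set (X →L[ℝ] X))) :
    (fun T : X →L[ℝ] X => P * T) '' (S : Set (X →L[ℝ] X)) ≠ {0} := by
  intro h
  have := mem_mul_image_self hP
  rw [h] at this
  exact ne_zero_of_opRank_eq_minRank hrank hP.2.2 this

/-- By idempotence, `P * S` is the set of members of `S` with range inside that of `P`; left
multiplication preserves this set when the range is invariant. -/
theorem isTwoSidedIdealOf_mul_image_iff {S : Subsemigroup (X →L[ℝ] X)} {P : X →L[ℝ] X}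
    (hP : P ∈ minRankProjections (S : Set (X →L[ℝ] X))) :
    IsTwoSidedIdealOf S ((fun T : X →L[ℝ] X => P * T) '' (S : Set (X →L[ℝ] X))) ↔
      ∀ T ∈ S, ∀ x ∈ Set.range P, T x ∈ Set.range P := by
  constructor
  · rintro h T hT _ ⟨x, rfl⟩
    obtain ⟨U, -, hU⟩ := h.2.2.2 P (mem_mul_image_self hP) T hT
    exact ⟨U x, congrArg (fun E : X →L[ℝ] X => E x) hU⟩
  · intro h
    have hR := isRightIdealOf_mul_image hP.1
    refine ⟨hR.1, hR.2.1, hR.2.2, ?_⟩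
    rintro _ ⟨T, hT, rfl⟩ B hB
    refine ⟨B * (P * T), S.mul_mem hB (S.mul_mem hP.1 hT),
      (mul_eq_right_iff_range_le hP.2.1).2 ?_⟩
    rintro _ ⟨x, rfl⟩
    exact h B hB _ ⟨T x, rfl⟩

end MinimalRank

/-! ### Minimal right ideals and minimal-rank projections. -/

section MinimalIdeals

variable {X : Type*} [NormedAddCommGroup X] [Lattice X] [IsOrderedAddMonoid X]
  [HasSolidNorm X] [NormedSpace ℝ X] [IsOrderedModule ℝ X]
  {S : Subsemigroup (X →L[ℝ] X)}

/-- Every operator of minimal rank generates a minimal-rank projection with the same range. -/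
theorem exists_mul_mem_minRankProjections
    (hpos : ∀ T ∈ S, IsPositiveOperator T) (hclosed : IsRPlusClosed (S : Set (X →L[ℝ] X)))
    (hirr : IsIdealIrreducible (S : Set (X →L[ℝ] X)))
    (hrank : minRank (S : Set (X →L[ℝ] X)) < ⊤) {A : X →L[ℝ] X} (hA : A ∈ S)
    (hAr : opRank A = minRank (S : Set (X →L[ℝ] X))) :
    ∃ T ∈ S, A * T ∈ minRankProjections (S : Set (X →L[ℝ] X)) ∧
      Set.range (A * T) = Set.range A := by
  have hA0 := ne_zero_of_opRank_eq_minRank hrank hAr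
  have range_eq : ∀ U ∈ S, A * U ≠ 0 → LinearMap.range ((A * U : X →L[ℝ] X) : X →ₗ[ℝ] X) =
      LinearMap.range (A : X →ₗ[ℝ] X) := fun U hU h0 =>
    range_eq_of_opRank_le (by rintro _ ⟨x, rfl⟩; exact ⟨U x, rfl⟩) (hAr ▸ hrank)
      (hAr ▸ minRank_le_opRank (S.mul_mem hA hU) h0)
  obtain ⟨U, hU, hU0⟩ := exists_mul_mul_ne_zero hpos hirr hA hA0 hA hA0
  have hAU0 : A * U ≠ 0 := fun h => hU0 (by rw [h, zero_mul])
  have hAU := range_eq U hU hAU0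
  -- `A * U` and `A` have the same range, so a zero square would give `A * U * A = 0`.
  have hsq : A * U * (A * U) ≠ 0 := by
    intro h
    refine hU0 (ContinuousLinearMap.ext fun x => ?_)
    obtain ⟨y, hy⟩ : A x ∈ LinearMap.range ((A * U : X →L[ℝ] X) : X →ₗ[ℝ] X) :=
      hAU ▸ ⟨x, rfl⟩
    change (A * U) (A x) = 0
    rw [← hy]
    exact congrArg (fun E : X →L[ℝ] X => E y) h
  have hAUS := S.mul_mem hA hU
  have hAUr : opRank (A * U) = minRank (S : Set (X →L[ℝ] X)) := by
    rw [← hAr, opRank_eq, opRank_eq, hAU]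
  obtain ⟨D, hD, hDC⟩ := exists_rightInverse_on_range hclosed hrank hAUS hAUr hsq
  -- With `C = A * U`, the relation `C * D * C = C` makes `C * D` idempotent.
  have hQC : A * (U * D) * (A * U) = A * U := ContinuousLinearMap.ext hDC
  have hQ0 : A * (U * D) ≠ 0 := fun h => hAU0 (by rw [← hQC, h, zero_mul])
  have hQ := range_eq _ (S.mul_mem hU hD) hQ0
  refine ⟨U * D, S.mul_mem hU hD, ⟨S.mul_mem hA (S.mul_mem hU hD), ?_, ?_⟩, ?_⟩
  · rw [IsIdempotentElem]
    nth_rw 2 [← mul_assoc A U D]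
    rw [← mul_assoc, hQC, mul_assoc]
  · rw [← hAr, opRank_eq, opRank_eq, hQ]
  · exact congrArg (fun W : Submodule ℝ X => (W : Set X)) hQ

theorem minRankProjections_nonempty
    (hpos : ∀ T ∈ S, IsPositiveOperator T) (hclosed : IsRPlusClosed (S : Set (X →L[ℝ] X)))
    (hirr : IsIdealIrreducible (S : Set (X →L[ℝ] X)))
    (hrank : minRank (S : Set (X →L[ℝ] X)) < ⊤) :
    (minRankProjections (S : Set (X →L[ℝ] X))).Nonempty := by
  obtain ⟨A, hA, -, hAr⟩ := exists_opRank_eq_minRank hrank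
  obtain ⟨T, -, hT, -⟩ := exists_mul_mem_minRankProjections hpos hclosed hirr hrank hA hAr
  exact ⟨_, hT⟩

theorem IsRightIdealOf.exists_ne_zero {M : Type*} [Mul M] [Zero M] {S : Subsemigroup M}
    {J : Set M} (hJ : IsRightIdealOf S J) (h0 : J ≠ {0}) : ∃ A ∈ J, A ≠ 0 := by
  by_contra! h
  exact h0 ((Set.nonempty_iff_ne_empty.1 hJ.1 |> fun hne =>
    (Set.subset_singleton_iff_eq.1 h).resolve_left hne))

theorem mul_image_subset {M : Type*} [Mul M] {S : Subsemigroup M}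
    {J : Set M} (hJ : IsRightIdealOf S J) {P : M} (hP : P ∈ J) :
    (fun T : M => P * T) '' (S : Set M) ⊆ J := by
  rintro _ ⟨T, hT, rfl⟩
  exact hJ.2.2 P hP T hT

/-- A nonzero `A ∈ J ⊆ P * S` has the same range as `P`, so `J` contains a projection `Q` with that
range, and `P = Q * P ∈ J`. -/
theorem isMinimalRightIdealOf_mul_image
    (hpos : ∀ T ∈ S, IsPositiveOperator T) (hclosed : IsRPlusClosed (S : Set (X →L[ℝ] X)))
    (hirr : IsIdealIrreducible (S : Set (X →L[ℝ] X)))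
    (hrank : minRank (S : Set (X →L[ℝ] X)) < ⊤) {P : X →L[ℝ] X}
    (hP : P ∈ minRankProjections (S : Set (X →L[ℝ] X))) :
    IsMinimalRightIdealOf S ((fun T : X →L[ℝ] X => P * T) '' (S : Set (X →L[ℝ] X))) := by
  refine ⟨⟨isRightIdealOf_mul_image hP.1, mul_image_ne_zero hrank hP⟩, ?_⟩
  rintro J ⟨hJ, hJ0⟩ hJP
  obtain ⟨A, hA, hA0⟩ := hJ.exists_ne_zero hJ0
  obtain ⟨T, hT, hPT⟩ := hJP hA
  have hAr : opRank A = minRank (S : Set (X →L[ℝ] X)) :=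
    le_antisymm (hPT ▸ hP.2.2 ▸ opRank_mul_le_left P T) (minRank_le_opRank (hJ.2.1 hA) hA0)
  obtain ⟨U, hU, hQ, hQA⟩ :=
    exists_mul_mem_minRankProjections hpos hclosed hirr hrank (hJ.2.1 hA) hAr
  refine mul_image_subset hJ ?_
  have hle : LinearMap.range (A : X →ₗ[ℝ] X) ≤ LinearMap.range (P : X →ₗ[ℝ] X) := by
    rintro _ ⟨x, rfl⟩
    exact ⟨T x, congrArg (fun E : X →L[ℝ] X => E x) hPT⟩
  have heq := range_eq_of_opRank_le hle (hP.2.2 ▸ hrank) (hP.2.2.trans hAr.symm).le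
  have hsub : Set.range P ⊆ Set.range (A * U) := by
    rw [hQA]
    exact (congrArg (fun W : Submodule ℝ X => (W : Set X)) heq).ge
  rw [← (mul_eq_right_iff_range_le hQ.2.1).2 hsub]
  exact hJ.2.2 _ (hJ.2.2 A hA U hU) P hP.1

/-- Primeness gives a nonzero product `A * T * B` with `A ∈ J` and `B` of minimal rank; it lies in
`J`, has minimal rank, and yields a projection in `J`. -/
theorem IsMinimalRightIdealOf.exists_eq_mul_image
    (hpos : ∀ T ∈ S, IsPositiveOperator T) (hclosed : IsRPlusClosed (S : Set (X →L[ℝ] X)))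
    (hirr : IsIdealIrreducible (S : Set (X →L[ℝ] X)))
    (hrank : minRank (S : Set (X →L[ℝ] X)) < ⊤) {J : Set (X →L[ℝ] X)}
    (hJ : IsMinimalRightIdealOf S J) :
    ∃ P ∈ minRankProjections (S : Set (X →L[ℝ] X)),
      J = (fun T : X →L[ℝ] X => P * T) '' (S : Set (X →L[ℝ] X)) := by
  obtain ⟨A, hA, hA0⟩ := hJ.1.1.exists_ne_zero hJ.1.2
  have hJS := hJ.1.1.2.1
  obtain ⟨B, hB, hB0, hBr⟩ := exists_opRank_eq_minRank hrank
  obtain ⟨T, hT, hT0⟩ := exists_mul_mul_ne_zero hpos hirr (hJS hA) hA0 hB hB0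
  have hmem : A * T * B ∈ J := hJ.1.1.2.2 _ (hJ.1.1.2.2 _ hA T hT) B hB
  obtain ⟨U, hU, hP, -⟩ := exists_mul_mem_minRankProjections hpos hclosed hirr hrank (hJS hmem)
    (le_antisymm (hBr ▸ opRank_mul_le_right _ _) (minRank_le_opRank (hJS hmem) hT0))
  have hPJ := hJ.1.1.2.2 _ hmem U hU
  have hsub := mul_image_subset hJ.1.1 hPJ
  exact ⟨_, hP, (hJ.2 ⟨isRightIdealOf_mul_image hP.1, mul_image_ne_zero hrank hP⟩ hsub).antisymm
    hsub⟩

theorem IsMinimalRightIdealOf.eq_of_mem {M : Type*} [Mul M] [Zero M] {S : Subsemigroup M}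
    {I J : Set M} (hI : IsMinimalRightIdealOf S I) (hJ : IsMinimalRightIdealOf S J) {A : M}
    (hAI : A ∈ I) (hAJ : A ∈ J) (hA0 : A ≠ 0) : I = J := by
  have hIJ : IsRightIdealOf S (I ∩ J) ∧ I ∩ J ≠ {0} := by
    refine ⟨⟨⟨A, hAI, hAJ⟩, fun B hB => hI.1.1.2.1 hB.1, fun B hB C hC =>
      ⟨hI.1.1.2.2 B hB.1 C hC, hJ.1.1.2.2 B hB.2 C hC⟩⟩, fun h => hA0 ?_⟩
    have hA : A ∈ I ∩ J := ⟨hAI, hAJ⟩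
    rw [h] at hA
    exact hA
  exact ((hI.2 hIJ Set.inter_subset_left).trans Set.inter_subset_right).antisymm
    ((hJ.2 hIJ Set.inter_subset_right).trans Set.inter_subset_left)

end MinimalIdeals

/-! ### Assembly of the three statements. -/

theorem mainTheorem11 {X : Type*} [NormedAddCommGroup X] [Lattice X] [IsOrderedAddMonoid X]
    [HasSolidNorm X] [NormedSpace ℝ X] [IsOrderedModule ℝ X] [CompleteSpace X]
    (S : Subsemigroup (X →L[ℝ] X))
    (hpos : ∀ T ∈ S, IsPositiveOperator T)
    (hclosed : IsRPlusClosed (S : Set (X →L[ℝ] X)))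
    (hirr : IsIdealIrreducible (S : Set (X →L[ℝ] X)))
    (hrank : minRank (S : Set (X →L[ℝ] X)) < ⊤) :
    (∀ J : Set (X →L[ℝ] X), IsMinimalRightIdealOf S J ↔
      ∃ P ∈ minRankProjections (S : Set (X →L[ℝ] X)),
        J = (fun T : X →L[ℝ] X => P * T) '' (S : Set (X →L[ℝ] X))) ∧
    (∀ P ∈ minRankProjections (S : Set (X →L[ℝ] X)),
      IsTwoSidedIdealOf S ((fun T : X →L[ℝ] X => P * T) '' (S : Set (X →L[ℝ] X))) ↔
        ∀ T ∈ S, ∀ x ∈ Set.range P, T x ∈ Set.range P) ∧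
    List.TFAE [
      ∀ P ∈ minRankProjections (S : Set (X →L[ℝ] X)),
        ∀ Q ∈ minRankProjections (S : Set (X →L[ℝ] X)), Set.range P = Set.range Q,
      ∀ J : Set (X →L[ℝ] X), IsMinimalRightIdealOf S J → IsTwoSidedIdealOf S J,
      ∃ J : Set (X →L[ℝ] X), IsMinimalRightIdealOf S J ∧ IsTwoSidedIdealOf S J,
      ∃! J : Set (X →L[ℝ] X), IsMinimalRightIdealOf S J] := by
  have hmin : ∀ P ∈ minRankProjections (S : Set (X →L[ℝ] X)),
      IsMinimalRightIdealOf S ((fun T : X →L[ℝ] X => P * T) '' (S : Set (X →L[ℝ] X))) :=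
    fun P hP => isMinimalRightIdealOf_mul_image hpos hclosed hirr hrank hP
  refine ⟨fun J => ⟨fun hJ => hJ.exists_eq_mul_image hpos hclosed hirr hrank, ?_⟩,
    fun P hP => isTwoSidedIdealOf_mul_image_iff hP, ?_⟩
  · rintro ⟨P, hP, rfl⟩
    exact hmin P hP
  obtain ⟨P₀, hP₀⟩ := minRankProjections_nonempty hpos hclosed hirr hrank
  tfae_have 1 → 2 := by
    intro h J hJ
    obtain ⟨P, hP, rfl⟩ := hJ.exists_eq_mul_image hpos hclosed hirr hrank
    rw [isTwoSidedIdealOf_mul_image_iff hP]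
    rintro T hT _ ⟨x, rfl⟩
    -- A nonzero `T * P` has minimal rank, so its range is that of a minimal-rank projection, hence
    -- that of `P`.
    by_cases h0 : T * P = 0
    · exact ⟨0, by
        rw [map_zero]
        exact congrArg (fun E : X →L[ℝ] X => E x) h0.symm⟩
    · have hTP := S.mul_mem hT hP.1
      obtain ⟨U, -, hQ, hQr⟩ := exists_mul_mem_minRankProjections hpos hclosed hirr hrank hTP
        (le_antisymm (hP.2.2 ▸ opRank_mul_le_right _ _) (minRank_le_opRank hTP h0))
      rw [h P hP _ hQ, hQr]
      exact ⟨x, rfl⟩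
  tfae_have 2 → 3 := fun h => ⟨_, hmin P₀ hP₀, h _ (hmin P₀ hP₀)⟩
  tfae_have 3 → 4 := by
    rintro ⟨J, hJ, hJ2⟩
    refine ⟨J, hJ, fun I hI => ?_⟩
    obtain ⟨A, hA, hA0⟩ := hI.1.1.exists_ne_zero hI.1.2
    obtain ⟨B, hB, hB0⟩ := hJ.1.1.exists_ne_zero hJ.1.2
    have hAS := hI.1.1.2.1 hA
    have hBS := hJ.1.1.2.1 hB
    obtain ⟨T, hT, hT0⟩ := exists_mul_mul_ne_zero hpos hirr hAS hA0 hBS hB0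
    -- The nonzero product `A * T * B` lies in `I` as a right multiple of `A`, and in the two-sided
    -- ideal `J` as a left multiple of `B`.
    refine hI.eq_of_mem hJ ?_ (hJ2.2.2.2 B hB _ (S.mul_mem hAS hT)) hT0
    rw [mul_assoc]
    exact hI.1.1.2.2 A hA _ (S.mul_mem hT hBS)
  tfae_have 4 → 1 := by
    intro h
    have hsub : ∀ P ∈ minRankProjections (S : Set (X →L[ℝ] X)),
        ∀ Q ∈ minRankProjections (S : Set (X →L[ℝ] X)), Set.range P ⊆ Set.range Q := by
      rintro P hP Q hQ _ ⟨x, rfl⟩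
      have hPQ := mem_mul_image_self hP
      -- Uniqueness gives `P ∈ P * S = Q * S`, which bounds the range of `P` by that of `Q`.
      rw [h.unique (hmin P hP) (hmin Q hQ)] at hPQ
      obtain ⟨T, -, hT⟩ := hPQ
      exact ⟨T x, congrArg (fun E : X →L[ℝ] X => E x) hT⟩
    exact fun P hP Q hQ => (hsub P hP Q hQ).antisymm (hsub Q hQ P hP)
  tfae_finish
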